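/- Let $\mathcal P(\mathbb R)$ be the set of Borel probability measures on $\mathbb R$ and $\mathbb C^+$ the open upper half-plane. For $\mu\in\mathcal P(\mathbb R)$ let $G_\mu(z)=\int_{\mathbb R}\frac{1}{z-x}\,\mu(dx)$, $F_\mu(z)=1/G_\mu(z)$ and $K_\mu(z)=z-F_\mu(z)$ for $z\in\mathbb C^+$. The Boolean convolution $\mu\uplus\nu$ of $\mu,\nu\in\mathcal P(\mathbb R)$ is the unique probability measure with $K_{\mu\uplus\nu}=K_\mu+K_\nu$ on $\mathbb C^+$. For $c\in(0,1)$ let $D_c(\mu)$ be the push-forward of $\mu$ by $x\mapsto cx$. A measure $\mu\in\mathcal P(\mathbb R)$ is called Boolean selfdecomposable if for every $c\in(0,1)$ there is $\mu_c\in\mathcal P(\mathbb R)$ such that $\mu=D_c(\mu)\uplus\mu_c$. As is well known, for every $\mu\in\mathcal P(\mathbb R)$ there is a unique pair $(b,\tau)$ (the Boolean generating pair) of a real number $b$ and a finite positive Borel measure $\tau$ on $\mathbb R$ such that $$K_\mu(z)=b+\int_{\mathbb R}\frac{1+xz}{z-x}\,\tau(dx),\qquad z\in\mathbb C^+.$$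 The Boolean Lévy measure of $\mu$ is $\nu(dx)=\frac{1+x^2}{x^2}\,\mathbf 1_{\mathbb R\setminus\{0\}}(x)\,\tau(dx)$. Let $\nu^{\mathrm{ac}}$ be its Lebesgue absolutely continuous part and put $k_\mu(x)=|x|\,\frac{d\nu^{\mathrm{ac}}}{dx}(x)$ for $x\ne0$. **Proposition.** A probability measure $\mu$ on $\mathbb R$ is Boolean selfdecomposable if and only if its Boolean Lévy measure $\nu$ is absolutely continuous with respect to Lebesgue measure and $k_\mu$ coincides Lebesgue-almost everywhere with a function that is unimodal with mode $0$, i.e. non-decreasing on $(-\infty,0)$ and non-increasing on $(0,\infty)$. -/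

import Mathlib

open MeasureTheory Set

noncomputable section

namespace BooleanSD

/-- The Cauchy transform `G_μ(z) = ∫ 1/(z - x) μ(dx)` (used for `Im z > 0`). -/
def cauchyTransform (μ : ProbabilityMeasure ℝ) (z : ℂ) : ℂ :=
  ∫ x : ℝ, 1 / (z - (x : ℂ)) ∂(μ : Measure ℝ)

/-- The `F`-transform `F_μ = 1 / G_μ`. -/
def fTransform (μ : ProbabilityMeasure ℝ) (z : ℂ) : ℂ := 1 / cauchyTransform μ z

/-- The self-energy function `K_μ(z) = z - F_μ(z)`. -/
def selfEnergy (μ : ProbabilityMeasure ℝ) (z : ℂ) : ℂ := z - fTransform μ z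

/-- `ρ` is a Boolean convolution of `μ` and `ν`: `K_ρ = K_μ + K_ν` on the upper half-plane. -/
def IsBooleanConv (μ ν ρ : ProbabilityMeasure ℝ) : Prop :=
  ∀ z : ℂ, 0 < z.im → selfEnergy ρ z = selfEnergy μ z + selfEnergy ν z

/-- The Boolean convolution `μ ⊎ ν`: the probability measure `ρ` with `K_ρ = K_μ + K_ν` on the
upper half-plane (there is exactly one such `ρ`). -/
def booleanConv (μ ν : ProbabilityMeasure ℝ) : ProbabilityMeasure ℝ :=
  Classical.epsilon (IsBooleanConv μ ν)

/-- The dilation `D_c(μ)`: the push-forward of `μ` by `x ↦ c x`. -/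
def dilation (c : ℝ) (μ : ProbabilityMeasure ℝ) : ProbabilityMeasure ℝ :=
  μ.map (f := fun x : ℝ => c * x) (measurable_const_mul c).aemeasurable

/-- Selfdecomposability with respect to a binary operation on the probability measures on `ℝ`. -/
def IsSelfdecomposable
    (op : ProbabilityMeasure ℝ → ProbabilityMeasure ℝ → ProbabilityMeasure ℝ)
    (μ : ProbabilityMeasure ℝ) : Prop :=
  ∀ c ∈ Ioo (0 : ℝ) 1, ∃ μc : ProbabilityMeasure ℝ, μ = op (dilation c μ) μc

/-- Boolean selfdecomposability, i.e. membership in the class `L(⊎)`. -/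
def IsBooleanSelfdecomposable (μ : ProbabilityMeasure ℝ) : Prop :=
  IsSelfdecomposable booleanConv μ

/-- `(b, τ)` is a Boolean generating pair of `μ`:
`K_μ(z) = b + ∫ (1 + x z)/(z - x) τ(dx)` on the upper half-plane. -/
def IsBooleanGeneratingPair (μ : ProbabilityMeasure ℝ) (p : ℝ × FiniteMeasure ℝ) : Prop :=
  ∀ z : ℂ, 0 < z.im →
    selfEnergy μ z =
      (p.1 : ℂ) + ∫ x : ℝ, (1 + (x : ℂ) * z) / (z - (x : ℂ)) ∂(p.2 : Measure ℝ)

/-- The Boolean generating pair of `μ` (there is exactly one). -/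
def booleanGeneratingPair (μ : ProbabilityMeasure ℝ) : ℝ × FiniteMeasure ℝ :=
  Classical.epsilon (IsBooleanGeneratingPair μ)

/-- The Boolean Lévy measure `ν(dx) = (1 + x²)/x² · 1_{ℝ ∖ {0}}(x) τ(dx)`, where `(b, τ)` is the
Boolean generating pair of `μ`. -/
def booleanLevyMeasure (μ : ProbabilityMeasure ℝ) : Measure ℝ :=
  (((booleanGeneratingPair μ).2 : Measure ℝ).restrict {0}ᶜ).withDensity
    fun x => ENNReal.ofReal ((1 + x ^ 2) / x ^ 2)

/-- `k_μ(x) = |x| · dν^{ac}/dx`, where `ν^{ac}` is the Lebesgue absolutely continuous part of the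
Boolean Lévy measure `ν` of `μ` (its density is the Radon-Nikodym derivative of the Lebesgue
decomposition). Only the values at `x ≠ 0` matter. -/
def kFun (μ : ProbabilityMeasure ℝ) (x : ℝ) : ℝ :=
  |x| * ((booleanLevyMeasure μ).rnDeriv volume x).toReal

/-- Unimodality with mode `0` of a function on `ℝ ∖ {0}`. -/
def IsUnimodalAtZero (k : ℝ → ℝ) : Prop :=
  MonotoneOn k (Iio 0) ∧ AntitoneOn k (Ioi 0)

end BooleanSD

end

noncomputable section

namespace BooleanSD

open Filter Topology Metric ProbabilityTheory
open scoped NNReal ENNReal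

/-! Boolean convolution adds self-energies, hence adds generating pairs, and every pair of a real
number and a finite positive measure is the pair of some probability measure. So `μ = D_c(μ) ⊎ μ_c`
is solvable exactly when the measure `τ_c` in the pair of `D_c(μ)` satisfies `τ_c ≤ τ`; the drift is
unconstrained. Since `K_{D_c μ}(z) = c K_μ(z/c)`, dilating `μ` pushes its Lévy measure `ν` forward
by `x ↦ c x`, while an atom of `τ` at `0` is only multiplied by `c² < 1`. Selfdecomposability
therefore means that `ν` dominates all its contractions (`isBooleanSelfdecomposable_iff`).

The rest is real analysis (`map_mul_le_iff_unimodal`). Averaging the domination over the dilation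
factor forces `ν` to be absolutely continuous. For a density `f`, domination says that, for each `t
> 1`, `|x| f(x)` does not increase almost everywhere when `x` is replaced by `t x`; Fubini and an
essential supremum turn this into a genuinely monotone version on each half-line.

The complex-analytic input is the Nevanlinna representation, obtained from Herglotz's theorem on the
disc by the Cayley transform. It gives existence of pairs and realisability of every pair;
uniqueness comes from smoothing with Cauchy laws. -/

/-! ### Cauchy transforms of finite measures and their injectivity -/

lemma sub_ofReal_ne_zero {z : ℂ} (hz : 0 < z.im) (x : ℝ) : z - x ≠ 0 := by
  intro h
  have := congrArg Complex.im h
  simp at this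
  exact hz.ne' this

lemma norm_one_div_sub_le {z : ℂ} (hz : 0 < z.im) (x : ℝ) :
    ‖1 / (z - x)‖ ≤ 1 / z.im := by
  rw [norm_div, norm_one]
  refine one_div_le_one_div_of_le hz ?_
  have := Complex.abs_im_le_norm (z - x)
  simp at this
  exact (le_abs_self _).trans this

lemma continuous_one_div_sub {z : ℂ} (hz : 0 < z.im) :
    Continuous fun x : ℝ => 1 / (z - x) := by
  have := sub_ofReal_ne_zero hz
  fun_prop (disch := assumption)

lemma integrable_one_div_sub (τ : Measure ℝ) [IsFiniteMeasure τ] {z : ℂ} (hz : 0 < z.im) :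
    Integrable (fun x : ℝ => 1 / (z - x)) τ :=
  .of_bound (continuous_one_div_sub hz).aestronglyMeasurable (1 / z.im)
    (ae_of_all _ (norm_one_div_sub_le hz))

lemma differentiableAt_integral_one_div_sub (τ : Measure ℝ) [IsFiniteMeasure τ] {z : ℂ}
    (hz : 0 < z.im) : DifferentiableAt ℂ (fun z : ℂ => ∫ x : ℝ, 1 / (z - x) ∂τ) z := by
  have h : (fun z : ℂ => ∫ x : ℝ, 1 / (z - x) ∂τ) = fun z => - resolventTransform τ z := by
    ext z
    rw [resolventTransform_apply, ← integral_neg]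
    refine integral_congr_ae (ae_of_all _ fun x => ?_)
    simp only [resolvent, Complex.coe_algebraMap, Ring.inverse_eq_inv']
    rw [← inv_neg, neg_sub, one_div]
  rw [h]
  refine (hasDerivAt_resolventTransform z ?_).differentiableAt.neg
  rintro ⟨x, -, rfl⟩
  simp at hz

lemma im_one_div_sub (z : ℂ) (x : ℝ) :
    (1 / (z - x)).im = -(z.im / ((z.re - x) ^ 2 + z.im ^ 2)) := by
  simp [Complex.inv_im, Complex.normSq_apply]
  ring

lemma im_integral_one_div_sub (τ : Measure ℝ) [IsFiniteMeasure τ] {z : ℂ} (hz : 0 < z.im) :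
    (∫ x : ℝ, 1 / (z - x) ∂τ).im = -∫ x : ℝ, z.im / ((z.re - x) ^ 2 + z.im ^ 2) ∂τ := by
  rw [← integral_neg]
  simp_rw [← im_one_div_sub]
  exact (integral_im (integrable_one_div_sub τ hz)).symm

lemma integrable_poisson (τ : Measure ℝ) [IsFiniteMeasure τ] {z : ℂ} (hz : 0 < z.im) :
    Integrable (fun x : ℝ => z.im / ((z.re - x) ^ 2 + z.im ^ 2)) τ := by
  refine (integrable_one_div_sub τ hz).im.neg.congr (ae_of_all _ fun x => ?_)
  simpa using congrArg Neg.neg (im_one_div_sub z x)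

/-- At height `γ`, the imaginary part of `1 / (z - x)` is `-π` times a translated Cauchy density, so
the Cauchy transform on a horizontal line records a smoothing of `τ`. -/
lemma conv_cauchyMeasure (τ : Measure ℝ) [IsFiniteMeasure τ] {γ : ℝ≥0} (hγ : γ ≠ 0) :
    τ.conv (cauchyMeasure 0 γ) = volume.withDensity fun u : ℝ =>
      ENNReal.ofReal (-(Real.pi⁻¹ * (∫ x : ℝ, 1 / ((⟨u, γ⟩ : ℂ) - x) ∂τ).im)) := by
  have hγ' : 0 < (γ : ℝ) := by positivity
  ext s hs
  rw [← lintegral_indicator_one hs, Measure.lintegral_conv (by fun_prop (disch := assumption)),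
    withDensity_apply _ hs, cauchyMeasure_of_scale_ne_zero _ hγ]
  have h1 : ∀ x : ℝ, ∫⁻ y, s.indicator 1 (x + y) ∂(volume.withDensity (cauchyPDF 0 γ)) =
      ∫⁻ u, s.indicator 1 u * cauchyPDF 0 γ (u - x) := by
    intro x
    rw [← lintegral_add_left_eq_self (μ := volume) _ x]
    refine (lintegral_withDensity_eq_lintegral_mul _ (measurable_cauchyPDF 0 γ)
      ((measurable_one.indicator hs).comp (measurable_const_add x))).trans ?_
    simp [mul_comm]
  simp_rw [h1]
  rw [lintegral_lintegral_swap, ← lintegral_indicator hs]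
  · refine lintegral_congr fun u => ?_
    by_cases hu : u ∈ s
    · simp only [hu, indicator_of_mem, Pi.one_apply, one_mul]
      rw [im_integral_one_div_sub τ (by simpa using hγ'), ← mul_neg, neg_neg,
        ← integral_const_mul, ofReal_integral_eq_lintegral_ofReal]
      · refine lintegral_congr fun x => ?_
        rw [cauchyPDF_def, cauchyPDFReal_def]
        simp [div_eq_mul_inv, mul_assoc]
      · exact (integrable_poisson τ (z := ⟨u, γ⟩) (by simpa using hγ')).const_mul _
      · exact ae_of_all _ fun x => by dsimp; positivity
    · simp [hu]
  · refine Measurable.aemeasurable ?_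
    exact ((measurable_one.indicator hs).comp measurable_snd).mul
      ((measurable_cauchyPDF 0 γ).comp (measurable_snd.sub measurable_fst))

lemma cauchyMeasure_eq_map {γ : ℝ≥0} (hγ : γ ≠ 0) :
    cauchyMeasure 0 γ = (cauchyMeasure 0 1).map (fun x => (γ : ℝ) * x) := by
  have hγ' : 0 < (γ : ℝ) := by positivity
  ext s hs
  rw [Measure.map_apply (measurable_const_mul _) hs, cauchyMeasure_of_scale_ne_zero _ hγ,
    cauchyMeasure_of_scale_ne_zero _ one_ne_zero, withDensity_apply _ hs,
    withDensity_apply _ (hs.preimage (measurable_const_mul _)),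
    ← lintegral_indicator hs, ← lintegral_indicator (hs.preimage (measurable_const_mul _))]
  conv_lhs => rw [← Real.smul_map_volume_mul_left hγ'.ne']
  have hm : Measurable (s.indicator (cauchyPDF 0 γ)) := (measurable_cauchyPDF 0 γ).indicator hs
  rw [lintegral_smul_measure, lintegral_map hm (measurable_const_mul _), smul_eq_mul,
    ← lintegral_const_mul _ (f := fun x => s.indicator (cauchyPDF 0 γ) (γ * x))
      (hm.comp (measurable_const_mul _))]
  refine lintegral_congr fun x => ?_
  by_cases hx : (γ : ℝ) * x ∈ s
  · simp only [hx, indicator_of_mem, mem_preimage, cauchyPDF_def]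
    rw [← ENNReal.ofReal_mul (abs_nonneg _), abs_of_pos hγ', cauchyPDFReal_def, cauchyPDFReal_def]
    congr 1
    simp only [NNReal.coe_one]
    field_simp
    ring
  · simp [hx]

/-- A finite measure is determined by the values of its Cauchy transform on a strip. -/
lemma ext_of_integral_one_div_sub {μ ν : Measure ℝ} [IsFiniteMeasure μ] [IsFiniteMeasure ν]
    (h : ∀ z : ℂ, 0 < z.im → z.im < 1 →
      ∫ x : ℝ, 1 / (z - x) ∂μ = ∫ x : ℝ, 1 / (z - x) ∂ν) : μ = ν := by
  refine Measure.ext_of_charFun (funext fun t => ?_)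
  -- For fixed `t`, the Cauchy law of small scale has nonzero characteristic function at `t`.
  -- Continuity suffices to cancel that factor, without an explicit formula.
  have hlim : Tendsto (fun γ : ℝ => charFun (cauchyMeasure 0 1) (γ * t)) (𝓝[>] 0) (𝓝 1) := by
    have : Continuous (fun γ : ℝ => charFun (cauchyMeasure 0 1) (γ * t)) :=
      continuous_charFun.comp (by fun_prop)
    simpa using (this.tendsto 0).mono_left nhdsWithin_le_nhds
  have h1 : ∀ᶠ γ : ℝ in 𝓝[>] 0, γ ∈ Ioo (0 : ℝ) 1 := Ioo_mem_nhdsGT one_pos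
  obtain ⟨γ, hγ, hne⟩ := (h1.and (hlim.eventually_ne one_ne_zero)).exists
  lift γ to ℝ≥0 using hγ.1.le
  have hγ0 : γ ≠ 0 := by rintro rfl; simp at hγ
  have hconv : μ.conv (cauchyMeasure 0 γ) = ν.conv (cauchyMeasure 0 γ) := by
    rw [conv_cauchyMeasure μ hγ0, conv_cauchyMeasure ν hγ0]
    congr! 5 with u
    rw [h _ hγ.1 hγ.2]
  have := congrArg (fun m => charFun m t) hconv
  simp only [charFun_conv] at this
  refine mul_right_cancel₀ ?_ this
  rwa [cauchyMeasure_eq_map hγ0, charFun_map_mul]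

/-! ### Herglotz representation on the unit disc -/

instance : MeasurableSpace Circle := borel Circle

instance : BorelSpace Circle := ⟨rfl⟩

/-- **Herglotz representation**: a non-negative real part of a holomorphic function on the unit
disc is the Poisson integral of a finite measure on the circle. -/
lemma exists_measure_re_eq_integral_poisson {h : ℂ → ℂ} (hd : DifferentiableOn ℂ h (ball 0 1))
    (hpos : ∀ w ∈ ball (0 : ℂ) 1, 0 ≤ (h w).re) :
    ∃ μ : FiniteMeasure Circle, ∀ w ∈ ball (0 : ℂ) 1,
      (h w).re = ∫ ζ : Circle, (((ζ : ℂ) + w) / (ζ - w)).re ∂(μ : Measure Circle) := by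
  have hmem : ∀ r ∈ Ioo (0 : ℝ) 1, ∀ w ∈ closedBall (0 : ℂ) 1, (r : ℂ) * w ∈ ball (0 : ℂ) 1 := by
    intro r hr w hw
    simp only [mem_closedBall, dist_zero_right, mem_ball, norm_mul, Complex.norm_real,
      Real.norm_eq_abs, abs_of_pos hr.1] at hw ⊢
    nlinarith [hr.1, hr.2, norm_nonneg w]
  have hcircle : ∀ θ : ℝ, circleMap 0 1 θ ∈ closedBall (0 : ℂ) 1 := fun θ => by simp
  have hexp : ∀ θ : ℝ, ((Circle.exp θ : Circle) : ℂ) = circleMap 0 1 θ := fun θ => by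
    simp [circleMap]
  -- the densities on the circles of radius `r`
  let ρ : ℝ → ℝ → ℝ := fun r θ => (2 * Real.pi)⁻¹ * (h (r * circleMap 0 1 θ)).re
  have hρc : ∀ r ∈ Ioo (0 : ℝ) 1, Continuous (ρ r) := by
    intro r hr
    have : Continuous fun θ => h (r * circleMap 0 1 θ) :=
      hd.continuousOn.comp_continuous (by fun_prop) fun θ => hmem r hr _ (hcircle θ)
    exact continuous_const.mul (Complex.continuous_re.comp this)
  have hρ0 : ∀ r ∈ Ioo (0 : ℝ) 1, ∀ θ, 0 ≤ ρ r θ := fun r hr θ =>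
    mul_nonneg (by positivity) (hpos _ (hmem r hr _ (hcircle θ)))
  let M : ℝ → Measure Circle := fun r =>
    ((volume.restrict (Ioc 0 (2 * Real.pi))).withDensity fun θ => ENNReal.ofReal (ρ r θ)).map
      Circle.exp
  have hMint : ∀ r ∈ Ioo (0 : ℝ) 1, ∀ φ : Circle → ℝ, Continuous φ →
      ∫ ζ, φ ζ ∂(M r) = ∫ θ in (0)..(2 * Real.pi), φ (Circle.exp θ) * ρ r θ := by
    intro r hr φ hφ
    rw [integral_map Circle.exp.continuous.measurable.aemeasurable hφ.aestronglyMeasurable,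
      integral_withDensity_eq_integral_toReal_smul
        (f := fun θ => ENNReal.ofReal (ρ r θ)) (hρc r hr).measurable.ennreal_ofReal
        (ae_of_all _ fun θ => ENNReal.ofReal_lt_top),
      intervalIntegral.integral_of_le (by positivity)]
    refine integral_congr_ae (ae_of_all _ fun θ => ?_)
    simp [ENNReal.toReal_ofReal (hρ0 r hr θ), mul_comm]
  have hkern : ∀ w ∈ ball (0 : ℂ) 1,
      Continuous fun ζ : Circle => (((ζ : ℂ) + w) / (ζ - w)).re := by
    intro w hw
    have : ∀ ζ : Circle, (ζ : ℂ) - w ≠ 0 := by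
      intro ζ h0
      rw [sub_eq_zero] at h0
      rw [← h0, mem_ball, dist_zero_right, Circle.norm_coe] at hw
      exact lt_irrefl _ hw
    fun_prop (disch := assumption)
  have hMpois : ∀ r ∈ Ioo (0 : ℝ) 1, ∀ w ∈ ball (0 : ℂ) 1,
      ∫ ζ : Circle, (((ζ : ℂ) + w) / (ζ - w)).re ∂(M r) = (h (r * w)).re := by
    intro r hr w hw
    have hd' : DiffContOnCl ℂ (fun w : ℂ => h (r * w)) (ball 0 1) := by
      refine DifferentiableOn.diffContOnCl ?_
      rw [closure_ball _ one_ne_zero]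
      exact hd.comp (by fun_prop) (hmem r hr)
    have hp := hd'.circleAverage_re_herglotzRieszKernel_smul' hw
    have hp' := congrArg Complex.re hp
    rw [hMint r hr _ (hkern w hw), ← hp', Real.circleAverage_def, Complex.smul_re,
      smul_eq_mul]
    have hcont : Continuous fun θ : ℝ => ((circleMap 0 1 θ - 0 + (w - 0)) /
        (circleMap 0 1 θ - 0 - (w - 0))).re • h (r * circleMap 0 1 θ) := by
      have h1 := (hkern w hw).comp Circle.exp.continuous
      simp only [Function.comp_def, hexp] at h1
      have h2 : Continuous fun θ => h (r * circleMap 0 1 θ) :=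
        hd.continuousOn.comp_continuous (by fun_prop) fun θ => hmem r hr _ (hcircle θ)
      simp only [sub_zero]
      exact h1.smul h2
    have hre := Complex.reCLM.intervalIntegral_comp_comm
      (hcont.intervalIntegrable (μ := volume) 0 (2 * Real.pi))
    simp only [Complex.reCLM_apply] at hre
    rw [← hre, ← intervalIntegral.integral_const_mul]
    refine intervalIntegral.integral_congr fun θ _ => ?_
    simp only [hexp, ρ, sub_zero, Complex.smul_re, smul_eq_mul]
    ring
  have hfin : ∀ r ∈ Ioo (0 : ℝ) 1, IsFiniteMeasure (M r) := by
    intro r hr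
    have : IsFiniteMeasure ((volume.restrict (Ioc 0 (2 * Real.pi))).withDensity
        fun θ => ENNReal.ofReal (ρ r θ)) :=
      isFiniteMeasure_withDensity_ofReal
        ((hρc r hr).integrableOn_Ioc (μ := volume)).hasFiniteIntegral
    infer_instance
  have hmass : ∀ r ∈ Ioo (0 : ℝ) 1, (M r).real univ = (h 0).re := by
    intro r hr
    have := hMpois r hr 0 (by simp)
    simpa using this
  -- a limit of the measures on the circles as the radius tends to `1`
  let r : ℕ → ℝ := fun n => 1 - 1 / (n + 2)
  have hr : ∀ n, r n ∈ Ioo (0 : ℝ) 1 := by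
    intro n
    have h1 : (1 : ℝ) / (n + 2) < 1 := by
      rw [div_lt_one (by positivity)]; linarith [(Nat.cast_nonneg n : (0 : ℝ) ≤ n)]
    have h2 : (0 : ℝ) < 1 / (n + 2) := by positivity
    exact ⟨by simp only [r]; linarith, by simp only [r]; linarith⟩
  have hrlim : Tendsto r atTop (𝓝 1) := by
    have := tendsto_const_nhds (x := (1 : ℝ)) |>.sub
      ((tendsto_one_div_add_atTop_nhds_zero_nat (𝕜 := ℝ)).comp (tendsto_add_atTop_nat 1))
    simp only [sub_zero] at this
    refine this.congr fun n => ?_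
    simp [r, add_assoc]
    norm_num
  let m : ℕ → FiniteMeasure Circle := fun n => ⟨M (r n), hfin _ (hr n)⟩
  let C : ℝ≥0 := ⟨(h 0).re, hpos 0 (by simp)⟩
  -- By the mean value property all these measures have mass `(h 0).re`, so they lie in a weakly
  -- compact set. Taking the limit along an ultrafilter avoids extracting a subsequence.
  have hcomp := isCompact_setOfPred_finiteMeasure_eq_of_compactSpace Circle C
  obtain ⟨μ, -, hμ⟩ := hcomp.ultrafilter_le_nhds
    ((hyperfilter ℕ).map m) (by
      rw [le_principal_iff]
      refine Filter.mem_map.2 (univ_mem' fun n => ?_)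
      exact NNReal.eq (hmass _ (hr n)))
  have hμ' : Tendsto m (hyperfilter ℕ : Filter ℕ) (𝓝 μ) := hμ
  rw [FiniteMeasure.tendsto_iff_forall_integral_tendsto] at hμ'
  refine ⟨μ, fun w hw => ?_⟩
  have h1 := hμ' (BoundedContinuousFunction.mkOfCompact ⟨_, hkern w hw⟩)
  simp only [BoundedContinuousFunction.mkOfCompact_apply, ContinuousMap.coe_mk] at h1
  have h2 : Tendsto (fun n => (h (r n * w)).re) (hyperfilter ℕ : Filter ℕ) (𝓝 (h w).re) := by
    have hc : ContinuousAt h w := (hd.differentiableAt (isOpen_ball.mem_nhds hw)).continuousAt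
    have hl : Tendsto (fun n => (r n : ℂ) * w) atTop (𝓝 w) := by
      have := ((Complex.continuous_ofReal.tendsto 1).comp hrlim).mul_const w
      simpa using this
    exact ((Complex.continuous_re.tendsto _).comp (hc.tendsto.comp hl)).mono_left
      Nat.hyperfilter_le_atTop
  refine tendsto_nhds_unique h2 (h1.congr fun n => ?_)
  exact hMpois _ (hr n) w hw

/-! ### Nevanlinna kernel and representation on the upper half-plane -/

lemma continuous_nevanlinnaKernel {z : ℂ} (hz : 0 < z.im) :
    Continuous fun x : ℝ => (1 + (x : ℂ) * z) / (z - x) := by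
  have := sub_ofReal_ne_zero hz
  fun_prop (disch := assumption)

lemma nevanlinnaKernel_eq {z : ℂ} (hz : 0 < z.im) (x : ℝ) :
    (1 + (x : ℂ) * z) / (z - x) = -z + (1 + z ^ 2) * (1 / (z - x)) := by
  have := sub_ofReal_ne_zero hz x
  field_simp
  ring

lemma integrable_nevanlinnaKernel (τ : Measure ℝ) [IsFiniteMeasure τ] {z : ℂ} (hz : 0 < z.im) :
    Integrable (fun x : ℝ => (1 + (x : ℂ) * z) / (z - x)) τ := by
  simp_rw [nevanlinnaKernel_eq hz]
  exact (integrable_const _).add ((integrable_one_div_sub τ hz).const_mul _)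

lemma integral_nevanlinnaKernel (τ : Measure ℝ) [IsFiniteMeasure τ] {z : ℂ} (hz : 0 < z.im) :
    ∫ x : ℝ, (1 + (x : ℂ) * z) / (z - x) ∂τ =
      -z * τ.real univ + (1 + z ^ 2) * ∫ x : ℝ, 1 / (z - x) ∂τ := by
  simp_rw [nevanlinnaKernel_eq hz]
  rw [integral_add (integrable_const _) ((integrable_one_div_sub τ hz).const_mul _),
    integral_const, integral_const_mul]
  simp [mul_comm]

lemma isOpen_upperHalfPlane : IsOpen {z : ℂ | 0 < z.im} :=
  isOpen_lt continuous_const Complex.continuous_im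

lemma differentiableOn_integral_nevanlinnaKernel (τ : Measure ℝ) [IsFiniteMeasure τ] :
    DifferentiableOn ℂ (fun z : ℂ => ∫ x : ℝ, (1 + (x : ℂ) * z) / (z - x) ∂τ)
      {z | 0 < z.im} := by
  have : DifferentiableOn ℂ (fun z : ℂ => -z * τ.real univ +
      (1 + z ^ 2) * ∫ x : ℝ, 1 / (z - x) ∂τ) {z | 0 < z.im} := by
    refine DifferentiableOn.add (by fun_prop) (DifferentiableOn.mul (by fun_prop) ?_)
    exact fun z hz => (differentiableAt_integral_one_div_sub τ hz).differentiableWithinAt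
  exact this.congr fun z hz => integral_nevanlinnaKernel τ hz

lemma re_one_add_div_one_sub (w : ℂ) :
    ((1 + w) / (1 - w)).re = (1 - Complex.normSq w) / Complex.normSq (1 - w) := by
  rw [Complex.div_re, ← add_div]
  congr 1
  simp [Complex.normSq_apply]
  ring

/-- The boundary value of the Cayley transform from the disc to the upper half-plane. -/
def cayleyReal (ζ : Circle) : ℝ := (Complex.I * (1 + ζ) / (1 - ζ)).re

lemma ofReal_cayleyReal (ζ : Circle) :
    (cayleyReal ζ : ℂ) = Complex.I * (1 + ζ) / (1 - ζ) := by
  refine Complex.ext rfl ?_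
  have := re_one_add_div_one_sub ζ
  rw [Circle.normSq_coe, sub_self, zero_div] at this
  rw [mul_div_assoc, Complex.I_mul_im, this, Complex.ofReal_im]

lemma measurable_cayleyReal : Measurable cayleyReal := by
  have : Measurable fun ζ : Circle => (ζ : ℂ) :=
    (show Continuous fun ζ : Circle => (ζ : ℂ) by fun_prop).measurable
  unfold cayleyReal
  fun_prop

/-- Under the Cayley transform the Herglotz kernel becomes `I` times the Nevanlinna kernel. The
point `ζ = 1` corresponds to infinity and has to be treated apart. -/
lemma re_herglotz_cayley {z : ℂ} (hz : 0 < z.im) {ζ : Circle} (hζ : ζ ≠ 1) :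
    (((ζ : ℂ) + (z - Complex.I) / (z + Complex.I)) /
      (ζ - (z - Complex.I) / (z + Complex.I))).re =
      -((1 + (cayleyReal ζ : ℂ) * z) / (z - cayleyReal ζ)).im := by
  have h1 : (1 : ℂ) - ζ ≠ 0 := by
    rw [sub_ne_zero]
    exact fun h => hζ (Circle.ext (by simp [h.symm]))
  have h2 : z + Complex.I ≠ 0 := by
    intro h
    have := congrArg Complex.im h
    simp at this
    linarith
  have hI := Complex.I_sq
  have h3 := sub_ofReal_ne_zero hz (cayleyReal ζ)
  have key : ((ζ : ℂ) + (z - Complex.I) / (z + Complex.I)) /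
      (ζ - (z - Complex.I) / (z + Complex.I)) =
      Complex.I * ((1 + (cayleyReal ζ : ℂ) * z) / (z - cayleyReal ζ)) := by
    rw [ofReal_cayleyReal] at h3 ⊢
    have h4 : z * (1 - ζ) - Complex.I * (1 + ζ) ≠ 0 := by
      intro h
      apply h3
      field_simp
      simpa using h
    have h5 : (ζ : ℂ) * (z + Complex.I) - (z - Complex.I) ≠ 0 := by
      intro h
      apply h4
      linear_combination -h
    have e1 : (ζ : ℂ) + (z - Complex.I) / (z + Complex.I) =
      (ζ * (z + Complex.I) + (z - Complex.I)) / (z + Complex.I) := by field_simp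
    have e2 : (ζ : ℂ) - (z - Complex.I) / (z + Complex.I) =
      (ζ * (z + Complex.I) - (z - Complex.I)) / (z + Complex.I) := by field_simp
    have e3 : 1 + Complex.I * (1 + ζ) / (1 - ζ) * z =
      ((1 - ζ) + Complex.I * (1 + ζ) * z) / (1 - ζ) := by field_simp
    have e4 : z - Complex.I * (1 + ζ) / (1 - ζ) =
      (z * (1 - ζ) - Complex.I * (1 + ζ)) / (1 - ζ) := by field_simp
    rw [e1, e2, e3, e4, div_div_div_cancel_right₀ h2, div_div_div_cancel_right₀ h1,
      ← mul_div_assoc, div_eq_div_iff h5 h4]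
    linear_combination (-(1 + ζ) * z * (ζ * (z + Complex.I) - (z - Complex.I))) * hI
  rw [key, Complex.I_mul_re]

/-- The imaginary part of a holomorphic self-map of the upper half-plane is a Poisson integral. -/
lemma exists_measure_im_eq {f : ℂ → ℂ} (hf : DifferentiableOn ℂ f {z | 0 < z.im})
    (hpos : ∀ z : ℂ, 0 < z.im → 0 ≤ (f z).im) :
    ∃ a : ℝ, ∃ τ : FiniteMeasure ℝ, 0 ≤ a ∧ ∀ z : ℂ, 0 < z.im →
      (f z).im = a * z.im -
        (∫ x : ℝ, (1 + (x : ℂ) * z) / (z - x) ∂(τ : Measure ℝ)).im := by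
  have hne : ∀ w ∈ ball (0 : ℂ) 1, 1 - w ≠ 0 := by
    intro w hw h
    rw [sub_eq_zero] at h
    simp [← h] at hw
  have hc : ∀ w ∈ ball (0 : ℂ) 1, 0 < (Complex.I * (1 + w) / (1 - w)).im := by
    intro w hw
    rw [mul_div_assoc, Complex.I_mul_im, re_one_add_div_one_sub]
    refine div_pos ?_ (Complex.normSq_pos.2 (hne w hw))
    rw [mem_ball, dist_zero_right] at hw
    rw [Complex.normSq_eq_norm_sq]
    nlinarith [norm_nonneg w]
  obtain ⟨μ, hμ⟩ := exists_measure_re_eq_integral_poisson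
    (h := fun w => -Complex.I * f (Complex.I * (1 + w) / (1 - w)))
    (by
      refine DifferentiableOn.const_mul (hf.comp ?_ hc) _
      fun_prop (disch := assumption))
    (fun w hw => by simpa using hpos _ (hc w hw))
  -- The mass at `ζ = 1` becomes the coefficient of the linear term, because the Poisson kernel
  -- there is `Re (-I z) = Im z`; the remaining mass is carried to the line.
  refine ⟨(μ : Measure Circle).real {1},
    ⟨((μ : Measure Circle).restrict {1}ᶜ).map cayleyReal, inferInstance⟩, by positivity, ?_⟩
  intro z hz
  have h2 : z + Complex.I ≠ 0 := by
    intro h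
    have := congrArg Complex.im h
    simp at this
    linarith
  have hw : (z - Complex.I) / (z + Complex.I) ∈ ball (0 : ℂ) 1 := by
    rw [mem_ball, dist_zero_right, norm_div, div_lt_one (norm_pos_iff.2 h2),
      Complex.norm_def, Complex.norm_def]
    refine Real.sqrt_lt_sqrt (Complex.normSq_nonneg _) ?_
    simp only [Complex.normSq_apply, Complex.sub_re, Complex.sub_im, Complex.add_re,
      Complex.add_im, Complex.I_re, Complex.I_im]
    nlinarith
  have hone : (1 + (z - Complex.I) / (z + Complex.I)) / (1 - (z - Complex.I) / (z + Complex.I)) =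
      -Complex.I * z := by
    have h3 := hne _ hw
    rw [div_eq_iff h3]
    field_simp
    linear_combination (2 * z) * Complex.I_sq
  have hcz : Complex.I * (1 + (z - Complex.I) / (z + Complex.I)) /
      (1 - (z - Complex.I) / (z + Complex.I)) = z := by
    rw [mul_div_assoc, hone]
    linear_combination (-z) * Complex.I_sq
  have h1 := hμ _ hw
  simp only [hcz] at h1
  have hcont : Continuous fun ζ : Circle => (((ζ : ℂ) + (z - Complex.I) / (z + Complex.I)) /
      (ζ - (z - Complex.I) / (z + Complex.I))).re := by
    have : ∀ ζ : Circle, (ζ : ℂ) - (z - Complex.I) / (z + Complex.I) ≠ 0 := by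
      intro ζ h0
      rw [sub_eq_zero] at h0
      rw [← h0, mem_ball, dist_zero_right, Circle.norm_coe] at hw
      exact lt_irrefl _ hw
    fun_prop (disch := assumption)
  have hint : Integrable (fun ζ : Circle => (((ζ : ℂ) + (z - Complex.I) / (z + Complex.I)) /
      (ζ - (z - Complex.I) / (z + Complex.I))).re) (μ : Measure Circle) :=
    (BoundedContinuousFunction.mkOfCompact ⟨_, hcont⟩).integrable _
  rw [← integral_add_compl (measurableSet_singleton (1 : Circle)) hint, integral_singleton,
    setIntegral_congr_fun (measurableSet_singleton (1 : Circle)).compl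
      (fun ζ hζ => re_herglotz_cayley hz hζ), integral_neg] at h1
  have h4 : (∫ x : ℝ, (1 + (x : ℂ) * z) / (z - x)
      ∂(((μ : Measure Circle).restrict {1}ᶜ).map cayleyReal)).im =
      ∫ ζ in ({1}ᶜ : Set Circle),
        ((1 + (cayleyReal ζ : ℂ) * z) / (z - cayleyReal ζ)).im ∂(μ : Measure Circle) := by
    rw [← integral_map (f := fun x : ℝ => ((1 + (x : ℂ) * z) / (z - x)).im)
      measurable_cayleyReal.aemeasurable
      (Complex.continuous_im.comp (continuous_nevanlinnaKernel hz)).aestronglyMeasurable]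
    exact (integral_im (integrable_nevanlinnaKernel _ hz)).symm
  simp only [FiniteMeasure.toMeasure_mk]
  rw [h4, sub_eq_add_neg]
  simpa [hone] using h1

/-- **Nevanlinna representation** of a holomorphic function on the upper half-plane with
non-negative imaginary part. -/
theorem exists_nevanlinna_representation {f : ℂ → ℂ}
    (hf : DifferentiableOn ℂ f {z | 0 < z.im}) (hpos : ∀ z : ℂ, 0 < z.im → 0 ≤ (f z).im) :
    ∃ a b : ℝ, ∃ τ : FiniteMeasure ℝ, 0 ≤ a ∧ ∀ z : ℂ, 0 < z.im →
      f z = b + a * z - ∫ x : ℝ, (1 + (x : ℂ) * z) / (z - x) ∂(τ : Measure ℝ) := by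
  obtain ⟨a, τ, ha, h⟩ := exists_measure_im_eq hf hpos
  let g : ℂ → ℂ := fun z => f z -
    (a * z - ∫ x : ℝ, (1 + (x : ℂ) * z) / (z - x) ∂(τ : Measure ℝ))
  have hg : AnalyticOnNhd ℂ g {z | 0 < z.im} := by
    refine DifferentiableOn.analyticOnNhd (hf.sub (DifferentiableOn.sub (by fun_prop) ?_))
      isOpen_upperHalfPlane
    exact differentiableOn_integral_nevanlinnaKernel _
  have hg0 : ∀ z ∈ {z : ℂ | 0 < z.im}, (g z).im = 0 := by
    intro z hz
    simp [g, h z hz]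
  have hconn : IsConnected {z : ℂ | 0 < z.im} :=
    ⟨⟨Complex.I, by simp⟩, (convex_halfSpace_im_gt 0).isPreconnected⟩
  -- By the open mapping principle, a holomorphic function with constant imaginary part on a
  -- connected open set is constant.
  obtain ⟨c, hc⟩ := hg.eq_const_of_im_eq_const hg0 isOpen_upperHalfPlane hconn
  have hcim : c.im = 0 := by
    rw [← hc Complex.I (by simp)]
    exact hg0 _ (by simp)
  refine ⟨a, c.re, τ, ha, fun z hz => ?_⟩
  have h1 := hc z hz
  have h2 : (c.re : ℂ) = c := Complex.ext rfl (by simp [hcim])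
  rw [h2, ← h1]
  simp only [g]
  ring

/-! ### Asymptotics along the imaginary axis; existence and uniqueness of generating pairs -/

lemma tendsto_inv_mul_I : Tendsto (fun y : ℝ => ((y : ℂ) * Complex.I)⁻¹) atTop (𝓝 0) := by
  rw [tendsto_zero_iff_norm_tendsto_zero]
  refine tendsto_inv_atTop_zero.congr' ?_
  filter_upwards [eventually_gt_atTop 0] with y hy
  simp [abs_of_pos hy]

/-- The integrand `iy / (iy - x)` is bounded by `1` and tends to `1`, so dominated convergence
recovers the total mass. -/
lemma tendsto_mul_integral_one_div_sub (τ : Measure ℝ) [IsFiniteMeasure τ] :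
    Tendsto (fun y : ℝ => (y * Complex.I) * ∫ x : ℝ, 1 / ((y * Complex.I : ℂ) - x) ∂τ) atTop
      (𝓝 (τ.real univ)) := by
  simp_rw [← integral_const_mul]
  have h1 : ((τ.real univ : ℝ) : ℂ) = ∫ _x : ℝ, (1 : ℂ) ∂τ := by simp
  rw [h1]
  refine tendsto_integral_filter_of_dominated_convergence (fun _ => 1) ?_ ?_
    (integrable_const _) (ae_of_all _ fun x => ?_)
  · filter_upwards [eventually_gt_atTop 0] with y hy
    exact (continuous_const.mul
      (continuous_one_div_sub (z := y * Complex.I) (by simpa using hy))).aestronglyMeasurable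
  · filter_upwards [eventually_gt_atTop 0] with y hy
    refine ae_of_all _ fun x => ?_
    have := norm_one_div_sub_le (z := y * Complex.I) (by simpa using hy) x
    rw [norm_mul]
    have hn : ‖(y * Complex.I : ℂ)‖ = y := by simp [abs_of_pos hy]
    rw [hn]
    calc y * _ ≤ y * (1 / y) := by gcongr; simpa using this
      _ = 1 := by field_simp
  · have h2 : Tendsto (fun y : ℝ => (1 - (x : ℂ) * (y * Complex.I)⁻¹)⁻¹) atTop (𝓝 1) := by
      have := (tendsto_const_nhds (x := (1 : ℂ))).sub (tendsto_inv_mul_I.const_mul (x : ℂ))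
      simp only [mul_zero, sub_zero] at this
      simpa using this.inv₀ one_ne_zero
    refine h2.congr' ?_
    filter_upwards [eventually_gt_atTop 0] with y hy
    have h3 : (y * Complex.I : ℂ) ≠ 0 := by simpa using hy.ne'
    have h4 := sub_ofReal_ne_zero (z := y * Complex.I) (by simpa using hy) x
    have : (y : ℂ) ≠ 0 := Complex.ofReal_ne_zero.2 hy.ne'
    have h5 : 1 - (x : ℂ) * (y * Complex.I)⁻¹ = (y * Complex.I - x) / (y * Complex.I) := by
      field_simp
    rw [h5, inv_div, mul_one_div]

lemma tendsto_integral_nevanlinnaKernel_div (τ : Measure ℝ) [IsFiniteMeasure τ] :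
    Tendsto (fun y : ℝ => (∫ x : ℝ, (1 + (x : ℂ) * (y * Complex.I)) / (y * Complex.I - x) ∂τ) /
      (y * Complex.I)) atTop (𝓝 0) := by
  have h := tendsto_mul_integral_one_div_sub τ
  have h0 : Tendsto (fun y : ℝ => ((y : ℂ) * Complex.I)⁻¹) atTop (𝓝 0) := tendsto_inv_mul_I
  have h1 := (tendsto_const_nhds (x := -((τ.real univ : ℝ) : ℂ))).add
    (((h0.mul h0).add_const 1).mul h)
  simp only [mul_zero, zero_add, one_mul, neg_add_cancel] at h1
  refine h1.congr' ?_
  filter_upwards [eventually_gt_atTop 0] with y hy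
  rw [integral_nevanlinnaKernel τ (by simpa using hy)]
  have : (y : ℂ) ≠ 0 := Complex.ofReal_ne_zero.2 hy.ne'
  field_simp

lemma cauchyTransform_im_neg (μ : ProbabilityMeasure ℝ) {z : ℂ} (hz : 0 < z.im) :
    (cauchyTransform μ z).im < 0 := by
  unfold cauchyTransform
  rw [im_integral_one_div_sub _ hz, neg_lt_zero]
  have hpos : ∀ x : ℝ, 0 < z.im / ((z.re - x) ^ 2 + z.im ^ 2) := fun x => by positivity
  rw [integral_pos_iff_support_of_nonneg (fun x => (hpos x).le) (integrable_poisson _ hz)]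
  have : Function.support (fun x : ℝ => z.im / ((z.re - x) ^ 2 + z.im ^ 2)) = univ :=
    eq_univ_of_forall fun x => (hpos x).ne'
  simp [this]

lemma cauchyTransform_ne_zero (μ : ProbabilityMeasure ℝ) {z : ℂ} (hz : 0 < z.im) :
    cauchyTransform μ z ≠ 0 := by
  intro h
  have := cauchyTransform_im_neg μ hz
  simp [h] at this

lemma im_inv_of_im_neg {w : ℂ} (hw : w.im < 0) : 0 < (1 / w).im := by
  rw [one_div, Complex.inv_im]
  refine div_pos (neg_pos.2 hw) (Complex.normSq_pos.2 ?_)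
  rintro rfl
  simp at hw

/-- Every probability measure on the line has a Boolean generating pair. -/
theorem exists_isBooleanGeneratingPair (μ : ProbabilityMeasure ℝ) :
    ∃ p, IsBooleanGeneratingPair μ p := by
  have hd : DifferentiableOn ℂ (fTransform μ) {z | 0 < z.im} := by
    intro z hz
    exact ((differentiableAt_const _).div (differentiableAt_integral_one_div_sub _ hz)
      (cauchyTransform_ne_zero μ hz)).differentiableWithinAt
  obtain ⟨a, b, τ, -, h⟩ := exists_nevanlinna_representation hd
    (fun z hz => (im_inv_of_im_neg (cauchyTransform_im_neg μ hz)).le)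
  -- The linear coefficient of `F_μ` is the limit of `F_μ(iy) / (iy)`, which is `1` because `μ` has
  -- mass one. Hence `z - F_μ(z)` has no linear term.
  have h1 : Tendsto (fun y : ℝ => fTransform μ (y * Complex.I) / (y * Complex.I)) atTop
      (𝓝 1) := by
    have := (tendsto_mul_integral_one_div_sub (μ : Measure ℝ)).inv₀ (by simp)
    simp only [probReal_univ, Complex.ofReal_one, inv_one] at this
    refine this.congr fun y => ?_
    rw [fTransform, cauchyTransform, div_div, one_div, mul_comm]
  have h2 : Tendsto (fun y : ℝ => fTransform μ (y * Complex.I) / (y * Complex.I)) atTop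
      (𝓝 a) := by
    have := ((tendsto_inv_mul_I.const_mul (b : ℂ)).add_const (a : ℂ)).sub
      (tendsto_integral_nevanlinnaKernel_div (τ : Measure ℝ))
    simp only [mul_zero, zero_add, sub_zero] at this
    refine this.congr' ?_
    filter_upwards [eventually_gt_atTop 0] with y hy
    rw [h _ (by simpa using hy)]
    have : (y : ℂ) ≠ 0 := Complex.ofReal_ne_zero.2 hy.ne'
    field_simp
  have ha : (a : ℂ) = 1 := tendsto_nhds_unique h2 h1
  refine ⟨(-b, τ), fun z hz => ?_⟩
  rw [selfEnergy, h z hz, ha]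
  push_cast
  ring

lemma isBooleanGeneratingPair_booleanGeneratingPair (μ : ProbabilityMeasure ℝ) :
    IsBooleanGeneratingPair μ (booleanGeneratingPair μ) :=
  Classical.epsilon_spec (exists_isBooleanGeneratingPair μ)

/-- The representing pair of a function on the upper half-plane is unique. -/
lemma generatingPair_ext {p q : ℝ × FiniteMeasure ℝ}
    (h : ∀ z : ℂ, 0 < z.im →
      (p.1 : ℂ) + ∫ x : ℝ, (1 + (x : ℂ) * z) / (z - x) ∂(p.2 : Measure ℝ) =
        q.1 + ∫ x : ℝ, (1 + (x : ℂ) * z) / (z - x) ∂(q.2 : Measure ℝ)) : p = q := by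
  -- At `z = I` the factor `1 + z²` vanishes, leaving the real part `b` and imaginary part `-τ(ℝ)`.
  have hI := h Complex.I (by simp)
  rw [integral_nevanlinnaKernel _ (by simp), integral_nevanlinnaKernel _ (by simp)] at hI
  simp only [Complex.I_sq, add_neg_cancel, zero_mul, add_zero] at hI
  have h1 : p.1 = q.1 := by simpa using congrArg Complex.re hI
  have h2 : (p.2 : Measure ℝ).real univ = (q.2 : Measure ℝ).real univ := by
    simpa using congrArg Complex.im hI
  refine Prod.ext h1 (Subtype.ext (ext_of_integral_one_div_sub (μ := (p.2 : Measure ℝ))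
    (ν := (q.2 : Measure ℝ)) fun z hz hz1 => ?_))
  have h3 := h z hz
  rw [integral_nevanlinnaKernel _ hz, integral_nevanlinnaKernel _ hz, h1, h2] at h3
  -- The restriction to the strip `Im z < 1` excludes the zero `z = I`.
  have h4 : 1 + z ^ 2 ≠ 0 := by
    intro h0
    have : (z - Complex.I) * (z + Complex.I) = 0 := by linear_combination h0 - Complex.I_sq
    rcases mul_eq_zero.1 this with h5 | h5
    · have := congrArg Complex.im h5
      simp at this
      linarith
    · have := congrArg Complex.im h5
      simp at this
      linarith
  exact mul_left_cancel₀ h4 (add_left_cancel (add_left_cancel h3))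

lemma IsBooleanGeneratingPair.unique {μ : ProbabilityMeasure ℝ} {p q : ℝ × FiniteMeasure ℝ}
    (hp : IsBooleanGeneratingPair μ p) (hq : IsBooleanGeneratingPair μ q) : p = q :=
  generatingPair_ext fun z hz => (hp z hz).symm.trans (hq z hz)

/-- A probability measure is determined by its self-energy function. -/
lemma ext_of_selfEnergy {μ ν : ProbabilityMeasure ℝ}
    (h : ∀ z : ℂ, 0 < z.im → selfEnergy μ z = selfEnergy ν z) : μ = ν := by
  refine Subtype.ext (ext_of_integral_one_div_sub (μ := (μ : Measure ℝ))
    (ν := (ν : Measure ℝ)) fun z hz _ => ?_)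
  have := h z hz
  simp only [selfEnergy, fTransform, sub_right_inj, one_div, inv_inj] at this
  simpa [cauchyTransform] using this

/-! ### Realising every pair; existence of Boolean convolutions -/

lemma im_nevanlinnaKernel (z : ℂ) (x : ℝ) :
    ((1 + (x : ℂ) * z) / (z - x)).im =
      -((1 + x ^ 2) * z.im / ((z.re - x) ^ 2 + z.im ^ 2)) := by
  rw [Complex.div_im]
  simp [Complex.normSq_apply]
  ring

lemma im_integral_nevanlinnaKernel (τ : Measure ℝ) [IsFiniteMeasure τ] {z : ℂ} (hz : 0 < z.im) :
    (∫ x : ℝ, (1 + (x : ℂ) * z) / (z - x) ∂τ).im =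
      -∫ x : ℝ, (1 + x ^ 2) * z.im / ((z.re - x) ^ 2 + z.im ^ 2) ∂τ := by
  rw [← integral_neg]
  simp_rw [← im_nevanlinnaKernel]
  exact (integral_im (integrable_nevanlinnaKernel τ hz)).symm

lemma integrable_poisson_mul (τ : Measure ℝ) [IsFiniteMeasure τ] {z : ℂ} (hz : 0 < z.im) :
    Integrable (fun x : ℝ => (1 + x ^ 2) * z.im / ((z.re - x) ^ 2 + z.im ^ 2)) τ := by
  refine (integrable_nevanlinnaKernel τ hz).im.neg.congr (ae_of_all _ fun x => ?_)
  simpa using congrArg Neg.neg (im_nevanlinnaKernel z x)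

lemma im_integral_nevanlinnaKernel_nonpos (τ : Measure ℝ) [IsFiniteMeasure τ] {z : ℂ}
    (hz : 0 < z.im) : (∫ x : ℝ, (1 + (x : ℂ) * z) / (z - x) ∂τ).im ≤ 0 := by
  rw [im_integral_nevanlinnaKernel τ hz, neg_nonpos]
  exact integral_nonneg fun x => by dsimp only; positivity

/-- A function with non-negative imaginary part on the upper half-plane that is asymptotic to
`-1 / z` along the imaginary axis is minus the Cauchy transform of a probability measure. -/
lemma exists_cauchyTransform_eq_neg {g : ℂ → ℂ} (hg : DifferentiableOn ℂ g {z | 0 < z.im})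
    (hpos : ∀ z : ℂ, 0 < z.im → 0 ≤ (g z).im)
    (hlim : Tendsto (fun y : ℝ => (y * Complex.I) * g (y * Complex.I)) atTop (𝓝 (-1))) :
    ∃ μ : ProbabilityMeasure ℝ, ∀ z : ℂ, 0 < z.im → cauchyTransform μ z = -g z := by
  obtain ⟨a, b, σ, -, h⟩ := exists_nevanlinna_representation hg hpos
  have hy : ∀ᶠ y : ℝ in atTop, 0 < y := eventually_gt_atTop 0
  have hg0 : Tendsto (fun y : ℝ => g (y * Complex.I)) atTop (𝓝 0) := by
    have := tendsto_inv_mul_I.mul hlim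
    rw [zero_mul] at this
    refine this.congr' ?_
    filter_upwards [hy] with y hy
    have : (y : ℂ) ≠ 0 := Complex.ofReal_ne_zero.2 hy.ne'
    field_simp
  have ha : a = 0 := by
    have h1 := tendsto_inv_mul_I.mul hg0
    rw [zero_mul] at h1
    have h2 := ((tendsto_inv_mul_I.const_mul (b : ℂ)).add_const (a : ℂ)).sub
      (tendsto_integral_nevanlinnaKernel_div (σ : Measure ℝ))
    simp only [mul_zero, zero_add, sub_zero] at h2
    refine Complex.ofReal_eq_zero.1 (tendsto_nhds_unique (h2.congr' ?_) h1)
    filter_upwards [hy] with y hy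
    rw [h _ (by simpa using hy)]
    have : (y : ℂ) ≠ 0 := Complex.ofReal_ne_zero.2 hy.ne'
    field_simp
  subst ha
  simp only [Complex.ofReal_zero, zero_mul, add_zero] at h
  -- the measure `(1 + x ^ 2) σ` is finite
  have hre : Tendsto (fun y : ℝ => y * (g (y * Complex.I)).im) atTop (𝓝 1) := by
    have := ((Complex.continuous_re.tendsto _).comp hlim).neg
    simpa [Function.comp_def] using this
  -- Fatou's lemma along `z = i n`: `n * Im g(i n)` tends to `1`, while the corresponding integrands
  -- tend to `1 + x²`.
  have hfat : ∫⁻ x, ENNReal.ofReal (1 + x ^ 2) ∂(σ : Measure ℝ) ≤ 1 := by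
    have hn : Tendsto (fun n : ℕ => (n : ℝ)) atTop atTop := tendsto_natCast_atTop_atTop
    let φ : ℕ → ℝ → ℝ≥0∞ := fun n x =>
      ENNReal.ofReal (n * ((1 + x ^ 2) * n / (x ^ 2 + n ^ 2)))
    have h1 : ∀ x, liminf (fun n => φ n x) atTop = ENNReal.ofReal (1 + x ^ 2) := by
      intro x
      refine Tendsto.liminf_eq (ENNReal.tendsto_ofReal ?_)
      have h2 : Tendsto (fun n : ℕ => (1 + x ^ 2) * (1 + x ^ 2 * ((n : ℝ)⁻¹ * (n : ℝ)⁻¹))⁻¹)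
          atTop (𝓝 ((1 + x ^ 2) * (1 + x ^ 2 * (0 * 0))⁻¹)) := by
        have h3 := tendsto_inv_atTop_zero.comp hn
        exact (((h3.mul h3).const_mul _).const_add 1).inv₀ (by simp) |>.const_mul _
      simp only [mul_zero, add_zero, inv_one, mul_one] at h2
      refine h2.congr' ?_
      filter_upwards [eventually_gt_atTop 0] with n hn
      have hn' : (0 : ℝ) < n := Nat.cast_pos.2 hn
      field_simp
      ring
    have h2 : ∀ᶠ n : ℕ in atTop, ∫⁻ x, φ n x ∂(σ : Measure ℝ) =
        ENNReal.ofReal (n * (g (n * Complex.I)).im) := by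
      filter_upwards [eventually_gt_atTop 0] with n hn
      have hn' : (0 : ℝ) < n := Nat.cast_pos.2 hn
      have hz : 0 < ((n : ℂ) * Complex.I).im := by simpa using hn'
      have hi := integrable_poisson_mul (σ : Measure ℝ) hz
      rw [h _ hz, Complex.sub_im, im_integral_nevanlinnaKernel _ hz, Complex.ofReal_im, zero_sub,
        neg_neg, ← integral_const_mul, ofReal_integral_eq_lintegral_ofReal (hi.const_mul _)
          (ae_of_all _ fun x => by dsimp only [Pi.zero_apply]; positivity)]
      simp [φ]
    calc ∫⁻ x, ENNReal.ofReal (1 + x ^ 2) ∂(σ : Measure ℝ)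
        = ∫⁻ x, liminf (fun n => φ n x) atTop ∂(σ : Measure ℝ) := by simp_rw [h1]
      _ ≤ liminf (fun n => ∫⁻ x, φ n x ∂(σ : Measure ℝ)) atTop :=
        lintegral_liminf_le fun n => by fun_prop
      _ = 1 := by
        rw [liminf_congr h2]
        have := (ENNReal.tendsto_ofReal (hre.comp hn)).liminf_eq
        simpa using this
  have hmeas : Measurable fun x : ℝ => ENNReal.ofReal (1 + x ^ 2) := by fun_prop
  let ρ : Measure ℝ := (σ : Measure ℝ).withDensity fun x => ENNReal.ofReal (1 + x ^ 2)
  have hρ : IsFiniteMeasure ρ := isFiniteMeasure_withDensity (hfat.trans_lt ENNReal.one_lt_top).ne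
  have hint : Integrable (fun x : ℝ => 1 + x ^ 2) (σ : Measure ℝ) := by
    refine ⟨by fun_prop, ?_⟩
    rw [hasFiniteIntegral_iff_ofReal
      (ae_of_all _ fun x => by dsimp only [Pi.zero_apply]; positivity)]
    exact hfat.trans_lt ENNReal.one_lt_top
  have hintx : Integrable (fun x : ℝ => (x : ℂ)) (σ : Measure ℝ) := by
    refine hint.mono' (by fun_prop) (ae_of_all _ fun x => ?_)
    rw [Complex.norm_real, Real.norm_eq_abs, abs_le]
    constructor <;> nlinarith [sq_nonneg (x - 1), sq_nonneg (x + 1)]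
  have hrep : ∀ z : ℂ, 0 < z.im → g z =
      (b - ∫ x : ℝ, (x : ℂ) ∂(σ : Measure ℝ)) - ∫ x : ℝ, 1 / (z - x) ∂ρ := by
    intro z hz
    have h1 : ∫ x : ℝ, 1 / (z - x) ∂ρ =
        ∫ x : ℝ, (1 + (x : ℂ) * z) / (z - x) - x ∂(σ : Measure ℝ) := by
      rw [integral_withDensity_eq_integral_toReal_smul hmeas
        (ae_of_all _ fun _ => ENNReal.ofReal_lt_top)]
      refine integral_congr_ae (ae_of_all _ fun x => ?_)
      have := sub_ofReal_ne_zero hz x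
      dsimp only
      rw [ENNReal.toReal_ofReal (by positivity), Complex.real_smul]
      push_cast
      field_simp
      ring
    rw [h z hz, h1, integral_sub (integrable_nevanlinnaKernel _ hz) hintx]
    ring
  have hρlim := tendsto_mul_integral_one_div_sub ρ
  have hc : (b - ∫ x : ℝ, (x : ℂ) ∂(σ : Measure ℝ)) = 0 := by
    have h1 := tendsto_inv_mul_I.mul hρlim
    rw [zero_mul] at h1
    have h2 := hg0.add h1
    rw [add_zero] at h2
    refine tendsto_nhds_unique (tendsto_const_nhds.congr' ?_) h2
    filter_upwards [hy] with y hy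
    have : (y * Complex.I : ℂ) ≠ 0 := by simpa using hy.ne'
    rw [hrep _ (by simpa using hy), inv_mul_cancel_left₀ this, sub_add_cancel]
  simp only [hc, zero_sub] at hrep
  have hone : ((ρ.real univ : ℝ) : ℂ) = 1 := by
    refine tendsto_nhds_unique hρlim ?_
    have := hlim.neg
    rw [neg_neg] at this
    refine this.congr' ?_
    filter_upwards [hy] with y hy
    rw [hrep _ (by simpa using hy)]
    ring
  have hprob : IsProbabilityMeasure ρ := by
    refine ⟨?_⟩
    have : ρ.real univ = 1 := by exact_mod_cast hone
    rwa [measureReal_def, ENNReal.toReal_eq_one_iff] at this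
  refine ⟨⟨ρ, hprob⟩, fun z hz => ?_⟩
  rw [hrep z hz, neg_neg]
  rfl

/-- Every pair of a real number and a finite measure is a Boolean generating pair. -/
theorem exists_probabilityMeasure_isBooleanGeneratingPair (p : ℝ × FiniteMeasure ℝ) :
    ∃ μ, IsBooleanGeneratingPair μ p := by
  let F : ℂ → ℂ := fun z => z - (p.1 + ∫ x : ℝ, (1 + (x : ℂ) * z) / (z - x) ∂(p.2 : Measure ℝ))
  have hF : ∀ z : ℂ, 0 < z.im → 0 < (F z).im := by
    intro z hz
    have := im_integral_nevanlinnaKernel_nonpos (p.2 : Measure ℝ) hz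
    simp only [F, Complex.sub_im, Complex.add_im, Complex.ofReal_im]
    linarith
  have hF0 : ∀ z : ℂ, 0 < z.im → F z ≠ 0 := by
    intro z hz h
    have := hF z hz
    simp [h] at this
  have hFd : DifferentiableOn ℂ F {z | 0 < z.im} :=
    differentiableOn_id.sub ((differentiableOn_const _).add
      (differentiableOn_integral_nevanlinnaKernel _))
  have hFlim : Tendsto (fun y : ℝ => F (y * Complex.I) / (y * Complex.I)) atTop (𝓝 1) := by
    have := ((tendsto_inv_mul_I.const_mul (p.1 : ℂ)).const_sub 1).sub
      (tendsto_integral_nevanlinnaKernel_div (p.2 : Measure ℝ))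
    simp only [mul_zero, sub_zero] at this
    refine this.congr' ?_
    filter_upwards [eventually_gt_atTop 0] with y hy
    have : (y : ℂ) ≠ 0 := Complex.ofReal_ne_zero.2 hy.ne'
    simp only [F]
    field_simp
    ring
  -- The required Cauchy transform is `1 / F`, so `-1 / F` is the function with non-negative
  -- imaginary part.
  obtain ⟨μ, hμ⟩ := exists_cauchyTransform_eq_neg (g := fun z => 1 / (-F z))
    ((differentiableOn_const _).div hFd.neg fun z hz => neg_ne_zero.2 (hF0 z hz))
    (fun z hz => (im_inv_of_im_neg (by simpa using hF z hz)).le) (by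
      have := (hFlim.inv₀ one_ne_zero).neg
      rw [inv_one] at this
      refine this.congr fun y => ?_
      rw [inv_div, one_div, inv_neg, mul_neg, div_eq_mul_inv])
  refine ⟨μ, fun z hz => ?_⟩
  have h1 := hμ z hz
  rw [selfEnergy, fTransform, h1, one_div, one_div, inv_neg, inv_neg, inv_neg, neg_neg, inv_inv]
  simp only [F]
  ring

/-- The Boolean convolution of two probability measures exists. -/
lemma isBooleanConv_booleanConv (μ ν : ProbabilityMeasure ℝ) :
    IsBooleanConv μ ν (booleanConv μ ν) := by
  refine Classical.epsilon_spec (p := IsBooleanConv μ ν) ?_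
  obtain ⟨p, hp⟩ := exists_isBooleanGeneratingPair μ
  obtain ⟨q, hq⟩ := exists_isBooleanGeneratingPair ν
  obtain ⟨ρ, hρ⟩ := exists_probabilityMeasure_isBooleanGeneratingPair (p.1 + q.1, p.2 + q.2)
  refine ⟨ρ, fun z hz => ?_⟩
  rw [hρ z hz, hp z hz, hq z hz, FiniteMeasure.toMeasure_add,
    integral_add_measure (integrable_nevanlinnaKernel _ hz) (integrable_nevanlinnaKernel _ hz)]
  push_cast
  ring

lemma eq_booleanConv_iff {μ ν ρ : ProbabilityMeasure ℝ} :
    ρ = booleanConv μ ν ↔ IsBooleanConv μ ν ρ := by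
  refine ⟨fun h => h ▸ isBooleanConv_booleanConv μ ν, fun h => ext_of_selfEnergy fun z hz => ?_⟩
  rw [h z hz, isBooleanConv_booleanConv μ ν z hz]

/-! ### Measures that dominate their contractions -/

lemma quasiMeasurePreserving_mul_left {a : ℝ} (ha : a ≠ 0) :
    Measure.QuasiMeasurePreserving (fun x : ℝ => a * x) volume volume := by
  refine ⟨measurable_const_mul a, ?_⟩
  rw [Real.map_volume_mul_left ha]
  exact Measure.smul_absolutelyContinuous

lemma quasiMeasurePreserving_mul_right {a : ℝ} (ha : a ≠ 0) :
    Measure.QuasiMeasurePreserving (fun x : ℝ => x * a) volume volume := by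
  simpa only [mul_comm] using quasiMeasurePreserving_mul_left ha

/-- A measure without atom at `0` that dominates its contractions is absolutely continuous. -/
lemma absolutelyContinuous_of_map_mul_le {ν : Measure ℝ} [SFinite ν] (h0 : ν {0} = 0)
    (h : ∀ c ∈ Ioo (0 : ℝ) 1, ν.map (fun x => c * x) ≤ ν) : ν ≪ (volume : Measure ℝ) := by
  refine Measure.AbsolutelyContinuous.mk fun E hE hE0 => ?_
  have h1 : ∀ t ∈ Ioo (1 : ℝ) 2, ν E ≤ ν ((fun x => t * x) ⁻¹' E) := by
    intro t ht
    have ht0 : t ≠ 0 := by linarith [ht.1]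
    have hle := h t⁻¹ ⟨by have := ht.1; positivity, inv_lt_one_of_one_lt₀ ht.1⟩
      ((fun x => t * x) ⁻¹' E)
    rw [Measure.map_apply (measurable_const_mul _) (hE.preimage (measurable_const_mul _))] at hle
    simpa [preimage_preimage, mul_inv_cancel_left₀ ht0] using hle
  have hm : Measurable fun q : ℝ × ℝ => E.indicator (1 : ℝ → ℝ≥0∞) (q.1 * q.2) :=
    (measurable_one.indicator hE).comp (measurable_fst.mul measurable_snd)
  -- By Tonelli, average over `t`: for each `x ≠ 0`, the set of `t` with `t x ∈ E` is null.
  have h2 : ∫⁻ t in Ioo (1 : ℝ) 2, ν ((fun x => t * x) ⁻¹' E) = 0 := by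
    have e1 : ∀ t : ℝ, ν ((fun x => t * x) ⁻¹' E) =
        ∫⁻ x, E.indicator (1 : ℝ → ℝ≥0∞) (t * x) ∂ν := by
      intro t
      rw [← lintegral_indicator_one (hE.preimage (measurable_const_mul t))]
      rfl
    simp_rw [e1]
    rw [lintegral_lintegral_swap hm.aemeasurable]
    have hx0 : ∀ᵐ x ∂ν, x ≠ 0 := by
      rw [ae_iff]
      simpa using h0
    rw [lintegral_eq_zero_iff' (Measurable.aemeasurable (hm.lintegral_prod_left'))]
    filter_upwards [hx0] with x hx
    refine (lintegral_eq_zero_iff' (hm.comp measurable_prodMk_right).aemeasurable).2 ?_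
    refine ae_restrict_of_ae ?_
    have hE' : ∀ᵐ y : ℝ, y ∉ E := measure_eq_zero_iff_ae_notMem.1 hE0
    filter_upwards [(quasiMeasurePreserving_mul_right hx).ae hE'] with t ht
    simp [ht]
  have h3 : ∫⁻ _t in Ioo (1 : ℝ) 2, ν E ≤ 0 :=
    h2 ▸ setLIntegral_mono' measurableSet_Ioo h1
  simpa [show (2 : ℝ) - 1 = 1 by norm_num] using h3

lemma map_mul_withDensity {c : ℝ} (hc : 0 < c) {f : ℝ → ℝ≥0∞} (hf : Measurable f) :
    (volume.withDensity f).map (fun x => c * x) =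
      volume.withDensity fun x => ENNReal.ofReal c⁻¹ * f (c⁻¹ * x) := by
  ext s hs
  have hm : Measurable ((fun x => c * x) ⁻¹' s |>.indicator f) :=
    hf.indicator (hs.preimage (measurable_const_mul c))
  rw [Measure.map_apply (measurable_const_mul c) hs,
    withDensity_apply _ (hs.preimage (measurable_const_mul c)), withDensity_apply _ hs,
    ← lintegral_indicator hs, ← lintegral_indicator (hs.preimage (measurable_const_mul c))]
  conv_lhs => rw [← Real.smul_map_volume_mul_left (inv_pos.2 hc).ne']
  rw [lintegral_smul_measure, lintegral_map hm (measurable_const_mul _), smul_eq_mul,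
    ← lintegral_const_mul _ (f := fun x => ((fun x => c * x) ⁻¹' s).indicator f (c⁻¹ * x))
      (hm.comp (measurable_const_mul _))]
  refine lintegral_congr fun x => ?_
  have : c * (c⁻¹ * x) = x := mul_inv_cancel_left₀ hc.ne' x
  by_cases hx : x ∈ s
  · simp [indicator, this, hx, abs_of_pos hc]
  · simp [indicator, this, hx]

lemma map_mul_withDensity_le_iff {c : ℝ} (hc : 0 < c) {f : ℝ → ℝ≥0∞} (hf : Measurable f) :
    (volume.withDensity f).map (fun x => c * x) ≤ volume.withDensity f ↔
      ∀ᵐ x : ℝ, ENNReal.ofReal c⁻¹ * f (c⁻¹ * x) ≤ f x := by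
  rw [map_mul_withDensity hc hf]
  refine ⟨fun h => ?_, fun h => withDensity_mono h⟩
  refine ae_le_of_forall_setLIntegral_le_of_sigmaFinite
    ((hf.comp (measurable_const_mul _)).const_mul _) fun s hs _ => ?_
  rw [← withDensity_apply _ hs, ← withDensity_apply _ hs]
  exact h s

/-- A function on the positive half-line that decreases almost everywhere under dilations
coincides almost everywhere with a non-increasing function. -/
lemma exists_antitoneOn_ae_eq {p : ℝ → ℝ≥0∞} (hp : Measurable p) (hfin : ∀ᵐ x : ℝ, p x < ∞)
    (h : ∀ t : ℝ, 1 < t → ∀ᵐ x : ℝ, 0 < x → p (t * x) ≤ p x) :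
    ∃ k : ℝ → ℝ, AntitoneOn k (Ioi 0) ∧ ∀ᵐ x : ℝ, 0 < x → k x = (p x).toReal := by
  have hmeas : MeasurableSet {q : ℝ × ℝ | 1 < q.1 → 0 < q.2 → p (q.1 * q.2) ≤ p q.2} := by
    refine (measurableSet_lt measurable_const measurable_fst).imp
      ((measurableSet_lt measurable_const measurable_snd).imp
        (measurableSet_le (hp.comp (measurable_fst.mul measurable_snd))
          (hp.comp measurable_snd)))
  have h1 : ∀ᵐ x : ℝ, ∀ᵐ t : ℝ, 1 < t → 0 < x → p (t * x) ≤ p x := by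
    refine (Measure.ae_ae_comm hmeas).1 (ae_of_all _ fun t => ?_)
    by_cases ht : 1 < t
    · filter_upwards [h t ht] with x hx _ using hx
    · exact ae_of_all _ fun x h => absurd h ht
  -- Substituting `y = t x` turns dilation inequalities into comparisons of `p x` with almost every
  -- later value.
  have h2 : ∀ᵐ x : ℝ, 0 < x → ∀ᵐ y : ℝ, x < y → p y ≤ p x := by
    filter_upwards [h1] with x hx hx0
    filter_upwards [(quasiMeasurePreserving_mul_right (inv_pos.2 hx0).ne').ae hx] with y hy hxy
    have := hy (by rw [← div_eq_mul_inv, lt_div_iff₀ hx0]; linarith) hx0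
    rwa [inv_mul_cancel_right₀ hx0.ne'] at this
  -- The essential supremum over `(x, ∞)` is non-increasing everywhere, which makes it the candidate
  -- monotone version.
  let K : ℝ → ℝ≥0∞ := fun x => essSup p (volume.restrict (Ioi x))
  have hK : Antitone K := fun x y hxy => essSup_mono_measure
    (Measure.absolutelyContinuous_of_le (Measure.restrict_mono (Ioi_subset_Ioi hxy) le_rfl))
  have hle : ∀ᵐ x : ℝ, 0 < x → K x ≤ p x := by
    filter_upwards [h2] with x hx hx0
    exact essSup_le_of_ae_le _ ((ae_restrict_iff' measurableSet_Ioi).2 (hx hx0))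
  have hKfin : ∀ x, 0 < x → K x < ∞ := by
    intro x hx
    have hne : ∃ y ∈ Ioo 0 x, (0 < y → K y ≤ p y) ∧ p y < ∞ := by
      by_contra! hcon
      have hz : volume (Ioo 0 x) = 0 := by
        refine measure_mono_null (fun y hy => ?_) (ae_iff.1 (hle.and hfin))
        exact fun hh => (hcon y hy hh.1).not_gt hh.2
      simp [hx.not_ge] at hz
    obtain ⟨y, hy, hy1, hy2⟩ := hne
    exact ((hK hy.2.le).trans (hy1 hy.1)).trans_lt hy2
  -- Countably many rational `q` give `p x ≤ K q` for all `q < x` at once. At the continuity points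
  -- of `K`, all but countably many, let `q` increase to `x`.
  have hge : ∀ᵐ x : ℝ, p x ≤ K x := by
    have h3 : ∀ᵐ x : ℝ, ∀ q : ℚ, (q : ℝ) < x → p x ≤ K q :=
      ae_all_iff.2 fun q => (ae_restrict_iff' measurableSet_Ioi).1 ae_le_essSup
    filter_upwards [h3, hK.countable_not_continuousAt.ae_notMem volume] with x hx hc
    have hc' : ContinuousAt K x := by simpa using hc
    by_contra! hlt
    obtain ⟨l, hl, hl'⟩ := exists_Ioc_subset_of_mem_nhds (hc'.eventually_lt_const hlt)
      ⟨x - 1, by linarith⟩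
    obtain ⟨q, hq1, hq2⟩ := exists_rat_btwn hl
    exact (hl' ⟨hq1, hq2.le⟩).not_ge (hx q hq2)
  refine ⟨fun x => (K x).toReal, fun x hx y _ hxy =>
    ENNReal.toReal_mono (hKfin x hx).ne (hK hxy), ?_⟩
  filter_upwards [hle, hge] with x h3 h4 h5
  rw [le_antisymm (h3 h5) h4]

/-- Measures dominating their contractions are those with density `k(x) / |x|`, `k` unimodal. -/
theorem map_mul_le_iff_unimodal {ν : Measure ℝ} [SigmaFinite ν] (h0 : ν {0} = 0) :
    (∀ c ∈ Ioo (0 : ℝ) 1, ν.map (fun x => c * x) ≤ ν) ↔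
      (ν ≪ (volume : Measure ℝ) ∧ ∃ k : ℝ → ℝ,
        k =ᵐ[(volume : Measure ℝ)] (fun x => |x| * (ν.rnDeriv volume x).toReal) ∧
          IsUnimodalAtZero k) := by
  have hf := Measure.measurable_rnDeriv ν (volume : Measure ℝ)
  have hfin : ∀ᵐ x : ℝ, ν.rnDeriv volume x < ∞ := Measure.rnDeriv_lt_top ν volume
  have hx0 : ∀ᵐ x : ℝ, x ≠ 0 := by simp [ae_iff]
  constructor
  · intro h
    have hac := absolutelyContinuous_of_map_mul_le h0 h
    refine ⟨hac, ?_⟩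
    have hν := Measure.withDensity_rnDeriv_eq ν volume hac
    set f := ν.rnDeriv volume with hfdef
    have hp : Measurable fun x : ℝ => ENNReal.ofReal |x| * f x := by fun_prop
    have hpfin : ∀ᵐ x : ℝ, ENNReal.ofReal |x| * f x < ∞ := by
      filter_upwards [hfin] with x hx using ENNReal.mul_lt_top ENNReal.ofReal_lt_top hx
    have hdil : ∀ t : ℝ, 1 < t → ∀ᵐ x : ℝ,
        ENNReal.ofReal |t * x| * f (t * x) ≤ ENNReal.ofReal |x| * f x := by
      intro t ht
      have ht0 : 0 < t := by linarith
      have h1 := h t⁻¹ ⟨inv_pos.2 ht0, inv_lt_one_of_one_lt₀ ht⟩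
      rw [← hν, map_mul_withDensity_le_iff (inv_pos.2 ht0) hf, inv_inv] at h1
      filter_upwards [h1] with x hx
      rw [abs_mul, abs_of_pos ht0, ENNReal.ofReal_mul ht0.le, mul_comm (ENNReal.ofReal t),
        mul_assoc]
      gcongr
    obtain ⟨k₁, hk₁, hk₁'⟩ := exists_antitoneOn_ae_eq hp hpfin
      fun t ht => (hdil t ht).mono fun x hx _ => hx
    have hneg : Measure.QuasiMeasurePreserving (fun x : ℝ => -x) volume volume :=
      (Measure.measurePreserving_neg volume).quasiMeasurePreserving
    obtain ⟨k₂, hk₂, hk₂'⟩ := exists_antitoneOn_ae_eq (hp.comp measurable_neg) (hneg.ae hpfin)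
      fun t ht => (hneg.ae (hdil t ht)).mono fun x hx _ => by simpa using hx
    refine ⟨fun x => if 0 < x then k₁ x else k₂ (-x), ?_, ?_, ?_⟩
    · filter_upwards [hk₁', hneg.ae hk₂', hx0] with x h1 h2 h3
      rcases lt_or_gt_of_ne h3 with hlt | hgt
      · simp [hlt.not_gt, h2 (neg_pos.2 hlt)]
      · simp [hgt, h1 hgt]
    · intro x hx y hy hxy
      have hx' : ¬ 0 < x := not_lt.2 (le_of_lt hx)
      have hy' : ¬ 0 < y := not_lt.2 (le_of_lt hy)
      simp only [hx', hy', if_false]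
      exact hk₂ (mem_Ioi.2 (neg_pos.2 hy)) (mem_Ioi.2 (neg_pos.2 hx)) (neg_le_neg hxy)
    · intro x hx y hy hxy
      have hx' : 0 < x := hx
      have hy' : 0 < y := hy
      simp only [hx', hy', if_true]
      exact hk₁ hx hy hxy
  · rintro ⟨hac, k, hk, hk₁, hk₂⟩ c ⟨hc0, hc1⟩
    have hν := Measure.withDensity_rnDeriv_eq ν volume hac
    set f := ν.rnDeriv volume with hfdef
    rw [← hν, map_mul_withDensity_le_iff hc0 hf]
    have hq := quasiMeasurePreserving_mul_left (inv_pos.2 hc0).ne'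
    filter_upwards [hfin, hq.ae hfin, hk, hq.ae hk, hx0] with x h1 h2 h3 h4 h5
    have hc1' : 1 ≤ c⁻¹ := (one_le_inv₀ hc0).2 hc1.le
    have hkx : k (c⁻¹ * x) ≤ k x := by
      rcases lt_or_gt_of_ne h5 with hlt | hgt
      · exact hk₁ (mul_neg_of_pos_of_neg (inv_pos.2 hc0) hlt) hlt (by nlinarith)
      · exact hk₂ hgt (mul_pos (inv_pos.2 hc0) hgt) (by nlinarith)
    rw [h3, h4, abs_mul, abs_of_pos (inv_pos.2 hc0), mul_assoc, mul_left_comm] at hkx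
    have h6 := le_of_mul_le_mul_left hkx (abs_pos.2 h5)
    rw [← ENNReal.ofReal_toReal h1.ne, ← ENNReal.ofReal_toReal h2.ne,
      ← ENNReal.ofReal_mul (inv_pos.2 hc0).le]
    exact ENNReal.ofReal_le_ofReal h6

/-! ### Lévy measures under dilation and the selfdecomposability criterion -/

/-- The Lévy measure `(1 + x²)/x² · 1_{ℝ ∖ {0}}(x) τ(dx)`. -/
def levyMeasure (τ : Measure ℝ) : Measure ℝ :=
  (τ.restrict {0}ᶜ).withDensity fun x => ENNReal.ofReal ((1 + x ^ 2) / x ^ 2)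

lemma measurable_levyDensity :
    Measurable fun x : ℝ => ENNReal.ofReal ((1 + x ^ 2) / x ^ 2) := by fun_prop

instance (τ : Measure ℝ) [IsFiniteMeasure τ] : SigmaFinite (levyMeasure τ) :=
  SigmaFinite.withDensity_of_ne_top' fun _ => ENNReal.ofReal_ne_top

lemma levyMeasure_singleton_zero (τ : Measure ℝ) : levyMeasure τ {0} = 0 :=
  withDensity_absolutelyContinuous _ _ (by
    rw [Measure.restrict_apply (measurableSet_singleton _)]
    simp)

lemma withDensity_mono_measure {α : Type*} [MeasurableSpace α] {μ ν : Measure α} (h : μ ≤ ν)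
    (f : α → ℝ≥0∞) : μ.withDensity f ≤ ν.withDensity f := by
  refine Measure.le_iff.2 fun s hs => ?_
  rw [withDensity_apply _ hs, withDensity_apply _ hs]
  exact lintegral_mono' (Measure.restrict_mono le_rfl h) le_rfl

lemma levyMeasure_mono {τ σ : Measure ℝ} (h : τ ≤ σ) : levyMeasure τ ≤ levyMeasure σ :=
  withDensity_mono_measure (Measure.restrict_mono le_rfl h) _

lemma withDensity_inv_levyMeasure (τ : Measure ℝ) :
    (levyMeasure τ).withDensity (fun x => (ENNReal.ofReal ((1 + x ^ 2) / x ^ 2))⁻¹) =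
      τ.restrict {0}ᶜ := by
  refine withDensity_inv_same measurable_levyDensity ?_ (ae_of_all _ fun _ => ENNReal.ofReal_ne_top)
  refine (ae_restrict_iff' (measurableSet_singleton _).compl).2 (ae_of_all _ fun x hx => ?_)
  have : x ≠ 0 := hx
  rw [ENNReal.ofReal_ne_zero_iff]
  positivity

/-- The Lévy density is invertible off `0`, but the Lévy measure does not see the atom at `0`, which
needs its own comparison. -/
lemma le_of_levyMeasure_le {τ σ : Measure ℝ} (h : levyMeasure τ ≤ levyMeasure σ)
    (h0 : τ {0} ≤ σ {0}) : τ ≤ σ := by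
  have h1 := withDensity_mono_measure h fun x => (ENNReal.ofReal ((1 + x ^ 2) / x ^ 2))⁻¹
  rw [withDensity_inv_levyMeasure, withDensity_inv_levyMeasure] at h1
  rw [← Measure.restrict_add_restrict_compl (μ := τ) (measurableSet_singleton (0 : ℝ)),
    ← Measure.restrict_add_restrict_compl (μ := σ) (measurableSet_singleton (0 : ℝ)),
    Measure.restrict_singleton, Measure.restrict_singleton]
  gcongr

/-- The density by which the measure of the generating pair changes under dilation. -/
def dilationDensity (c x : ℝ) : ℝ := (c ^ 2 + c ^ 2 * x ^ 2) / (1 + c ^ 2 * x ^ 2)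

lemma measurable_dilationDensity (c : ℝ) :
    Measurable fun x => ENNReal.ofReal (dilationDensity c x) := by
  unfold dilationDensity
  fun_prop

lemma dilationDensity_nonneg (c x : ℝ) : 0 ≤ dilationDensity c x := by
  unfold dilationDensity
  positivity

lemma dilationDensity_le_one {c : ℝ} (hc : c ∈ Ioo (0 : ℝ) 1) (x : ℝ) :
    dilationDensity c x ≤ 1 := by
  unfold dilationDensity
  rw [div_le_one (by positivity)]
  nlinarith [hc.1, hc.2]

/-- The measure of the generating pair of the dilation by `c`. -/
def dilatedMeasure (c : ℝ) (τ : Measure ℝ) : Measure ℝ :=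
  (τ.withDensity fun x => ENNReal.ofReal (dilationDensity c x)).map fun x => c * x

lemma withDensity_dilationDensity_le {c : ℝ} (hc : c ∈ Ioo (0 : ℝ) 1) (τ : Measure ℝ) :
    (τ.withDensity fun x => ENNReal.ofReal (dilationDensity c x)) ≤ τ := by
  conv_rhs => rw [← withDensity_one (μ := τ)]
  exact withDensity_mono (ae_of_all _ fun x =>
    ENNReal.ofReal_le_one.2 (dilationDensity_le_one hc x))

lemma isFiniteMeasure_dilatedMeasure {c : ℝ} (hc : c ∈ Ioo (0 : ℝ) 1) (τ : Measure ℝ)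
    [IsFiniteMeasure τ] : IsFiniteMeasure (dilatedMeasure c τ) := by
  have := isFiniteMeasure_of_le _ (withDensity_dilationDensity_le hc τ)
  unfold dilatedMeasure
  infer_instance

/-- The dilated measure as a finite measure. -/
def dilatedFiniteMeasure {c : ℝ} (hc : c ∈ Ioo (0 : ℝ) 1) (τ : FiniteMeasure ℝ) :
    FiniteMeasure ℝ :=
  ⟨dilatedMeasure c (τ : Measure ℝ), isFiniteMeasure_dilatedMeasure hc _⟩

lemma toMeasure_dilatedFiniteMeasure {c : ℝ} (hc : c ∈ Ioo (0 : ℝ) 1) (τ : FiniteMeasure ℝ) :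
    (dilatedFiniteMeasure hc τ : Measure ℝ) = dilatedMeasure c (τ : Measure ℝ) := rfl

lemma dilatedMeasure_singleton_zero_le {c : ℝ} (hc : c ∈ Ioo (0 : ℝ) 1) (τ : Measure ℝ) :
    dilatedMeasure c τ {0} ≤ τ {0} := by
  have h0 : (fun x : ℝ => c * x) ⁻¹' {0} = {0} := by
    ext x
    simp [hc.1.ne']
  rw [dilatedMeasure, Measure.map_apply (measurable_const_mul c) (measurableSet_singleton _), h0]
  exact withDensity_dilationDensity_le hc τ _

/-- The dilation density is exactly the ratio of the Lévy densities at `x` and at `c x`. -/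
lemma levyMeasure_dilatedMeasure {c : ℝ} (hc : c ≠ 0) (τ : Measure ℝ) :
    levyMeasure (dilatedMeasure c τ) = (levyMeasure τ).map fun x => c * x := by
  have hm := measurable_const_mul c
  have hpre : (fun x : ℝ => c * x) ⁻¹' {0}ᶜ = {0}ᶜ := by
    ext x
    simp [hc]
  have h0 : MeasurableSet ({0}ᶜ : Set ℝ) := (measurableSet_singleton _).compl
  have e1 : (dilatedMeasure c τ).restrict {0}ᶜ = ((τ.restrict {0}ᶜ).withDensity
      fun x => ENNReal.ofReal (dilationDensity c x)).map fun x => c * x := by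
    rw [dilatedMeasure, Measure.restrict_map hm h0, hpre, restrict_withDensity h0]
  ext s hs
  rw [Measure.map_apply hm hs, levyMeasure, levyMeasure, e1, withDensity_apply _ hs,
    withDensity_apply _ (hm hs), setLIntegral_map hs measurable_levyDensity hm,
    setLIntegral_withDensity_eq_setLIntegral_mul _ (measurable_dilationDensity c)
      (g := fun x => ENNReal.ofReal ((1 + (c * x) ^ 2) / (c * x) ^ 2))
      (measurable_levyDensity.comp hm) (hm hs)]
  refine lintegral_congr_ae (ae_restrict_of_ae ((ae_restrict_iff' h0).2
    (ae_of_all _ fun x hx => ?_)))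
  have hx' : x ≠ 0 := hx
  simp only [Pi.mul_apply]
  rw [← ENNReal.ofReal_mul (dilationDensity_nonneg c x), dilationDensity]
  congr 1
  field_simp

lemma cauchyTransform_dilation {c : ℝ} (hc : c ≠ 0) (μ : ProbabilityMeasure ℝ) (z : ℂ) :
    cauchyTransform (dilation c μ) z = (c : ℂ)⁻¹ * cauchyTransform μ (z / c) := by
  have hc' : (c : ℂ) ≠ 0 := Complex.ofReal_ne_zero.2 hc
  simp only [cauchyTransform, dilation, ProbabilityMeasure.toMeasure_map]
  rw [integral_map (measurable_const_mul c).aemeasurable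
    (Measurable.aestronglyMeasurable (by fun_prop)), ← integral_const_mul]
  refine integral_congr_ae (ae_of_all _ fun x => ?_)
  have : z / c - x = (z - c * x) / c := by field_simp
  simp only [this, one_div, inv_div, Complex.ofReal_mul]
  field_simp

lemma selfEnergy_dilation {c : ℝ} (hc : c ≠ 0) (μ : ProbabilityMeasure ℝ) (z : ℂ) :
    selfEnergy (dilation c μ) z = c * selfEnergy μ (z / c) := by
  have hc' : (c : ℂ) ≠ 0 := Complex.ofReal_ne_zero.2 hc
  rw [selfEnergy, selfEnergy, fTransform, fTransform, cauchyTransform_dilation hc, mul_sub,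
    mul_div_cancel₀ _ hc', one_div, one_div, mul_inv, inv_inv]

/-- The generating pair of a dilation. -/
lemma exists_isBooleanGeneratingPair_dilation {c : ℝ} (hc : c ∈ Ioo (0 : ℝ) 1)
    {μ : ProbabilityMeasure ℝ} {p : ℝ × FiniteMeasure ℝ} (hp : IsBooleanGeneratingPair μ p) :
    ∃ b : ℝ, IsBooleanGeneratingPair (dilation c μ)
      (b, dilatedFiniteMeasure hc p.2) := by
  have hc0 : (c : ℂ) ≠ 0 := Complex.ofReal_ne_zero.2 hc.1.ne'
  -- `B` is the discrepancy between `c` times the kernel at `z / c` and the weighted kernel at the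
  -- atom `c x`. It is real and independent of `z`, so its integral is absorbed by the drift.
  let B : ℝ → ℝ := fun x => c * x * (1 - c ^ 2) / (1 + c ^ 2 * x ^ 2)
  have hB : Integrable B (p.2 : Measure ℝ) := by
    refine .of_bound (Measurable.aestronglyMeasurable (by fun_prop)) 1 (ae_of_all _ fun x => ?_)
    have h1 : 0 ≤ 1 - c ^ 2 := by nlinarith [hc.1, hc.2]
    have h2 : 1 - c ^ 2 ≤ 1 := by nlinarith [sq_nonneg c]
    have h3 : |c * x| ≤ 1 + c ^ 2 * x ^ 2 := by
      rw [abs_le]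
      constructor <;> nlinarith [sq_nonneg (c * x - 1), sq_nonneg (c * x + 1)]
    rw [Real.norm_eq_abs, abs_div, abs_mul, abs_of_nonneg h1,
      abs_of_pos (show 0 < 1 + c ^ 2 * x ^ 2 by positivity), div_le_one (by positivity)]
    nlinarith [abs_nonneg (c * x)]
  refine ⟨c * p.1 + ∫ x, B x ∂(p.2 : Measure ℝ), fun z hz => ?_⟩
  have hzc : 0 < (z / c).im := by
    rw [Complex.div_ofReal_im]
    exact div_pos hz hc.1
  have hkey : ∫ x : ℝ, (1 + (x : ℂ) * z) / (z - x) ∂(dilatedMeasure c (p.2 : Measure ℝ)) =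
      ∫ x : ℝ, c * ((1 + (x : ℂ) * (z / c)) / (z / c - x)) - B x ∂(p.2 : Measure ℝ) := by
    rw [dilatedMeasure, integral_map (measurable_const_mul c).aemeasurable
      (continuous_nevanlinnaKernel hz).aestronglyMeasurable,
      integral_withDensity_eq_integral_toReal_smul (measurable_dilationDensity c)
        (ae_of_all _ fun _ => ENNReal.ofReal_lt_top)]
    refine integral_congr_ae (ae_of_all _ fun x => ?_)
    have h1 := sub_ofReal_ne_zero hz (c * x)
    have h2 : (1 + (c : ℂ) ^ 2 * x ^ 2) ≠ 0 := by
      have : (1 + c ^ 2 * x ^ 2 : ℝ) ≠ 0 := by positivity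
      exact_mod_cast this
    have h3 : z / c - x = (z - c * x) / c := by field_simp
    have h4 : (1 + (x : ℂ) * (z / c)) = (c + x * z) / c := by field_simp
    dsimp only [B]
    rw [ENNReal.toReal_ofReal (dilationDensity_nonneg c x), Complex.real_smul, dilationDensity,
      h3, h4, div_div_div_cancel_right₀ hc0]
    push_cast at h1 ⊢
    field_simp
    ring
  rw [selfEnergy_dilation hc.1.ne', hp _ hzc]
  have hsub : ∫ x : ℝ, c * ((1 + (x : ℂ) * (z / c)) / (z / c - x)) - B x ∂(p.2 : Measure ℝ) =
      c * (∫ x : ℝ, (1 + (x : ℂ) * (z / c)) / (z / c - x) ∂(p.2 : Measure ℝ)) -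
        (∫ x, B x ∂(p.2 : Measure ℝ) : ℝ) := by
    have hB' : Integrable (fun x => (B x : ℂ)) (p.2 : Measure ℝ) := hB.ofReal
    rw [integral_sub ((integrable_nevanlinnaKernel _ hzc).const_mul _) hB',
      integral_const_mul, integral_complex_ofReal]
  simp only [toMeasure_dilatedFiniteMeasure]
  rw [hkey, hsub]
  push_cast
  ring

/-- Boolean selfdecomposability in terms of the Boolean Lévy measure. -/
theorem isBooleanSelfdecomposable_iff (μ : ProbabilityMeasure ℝ) :
    IsBooleanSelfdecomposable μ ↔
      ∀ c ∈ Ioo (0 : ℝ) 1, (booleanLevyMeasure μ).map (fun x => c * x) ≤ booleanLevyMeasure μ := by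
  have hp := isBooleanGeneratingPair_booleanGeneratingPair μ
  have hlevy : booleanLevyMeasure μ = levyMeasure ((booleanGeneratingPair μ).2 : Measure ℝ) := rfl
  rw [hlevy]
  generalize booleanGeneratingPair μ = p at hp
  refine forall₂_congr fun c hc => ?_
  obtain ⟨b, hb⟩ := exists_isBooleanGeneratingPair_dilation hc hp
  have hfin := isFiniteMeasure_dilatedMeasure hc (p.2 : Measure ℝ)
  rw [← levyMeasure_dilatedMeasure hc.1.ne']
  constructor
  · rintro ⟨μc, hμc⟩
    rw [eq_booleanConv_iff] at hμc
    obtain ⟨q, hq⟩ := exists_isBooleanGeneratingPair μc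
    have hsum : IsBooleanGeneratingPair μ
        (b + q.1, dilatedFiniteMeasure hc p.2 + q.2) := by
      intro z hz
      rw [hμc z hz, hb z hz, hq z hz, FiniteMeasure.toMeasure_add,
        integral_add_measure (integrable_nevanlinnaKernel _ hz) (integrable_nevanlinnaKernel _ hz)]
      push_cast
      ring
    have h1 := congrArg (fun r : ℝ × FiniteMeasure ℝ => (r.2 : Measure ℝ)) (hp.unique hsum)
    simp only [FiniteMeasure.toMeasure_add, toMeasure_dilatedFiniteMeasure] at h1
    refine levyMeasure_mono ?_
    conv_rhs => rw [h1]
    exact Measure.le_add_right le_rfl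
  · intro h
    have hle := le_of_levyMeasure_le h (dilatedMeasure_singleton_zero_le hc _)
    have hsub := Measure.sub_add_cancel_of_le hle
    -- Any positive remainder is admissible, so subtracting the two pairs already determines the
    -- cofactor `μ_c`.
    obtain ⟨μc, hμc⟩ := exists_probabilityMeasure_isBooleanGeneratingPair
      (p.1 - b, ⟨(p.2 : Measure ℝ) - dilatedMeasure c (p.2 : Measure ℝ), inferInstance⟩)
    refine ⟨μc, eq_booleanConv_iff.2 fun z hz => ?_⟩
    rw [hp z hz, hb z hz, hμc z hz]
    simp only [FiniteMeasure.toMeasure_mk, toMeasure_dilatedFiniteMeasure]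
    conv_lhs => rw [← hsub]
    rw [integral_add_measure (integrable_nevanlinnaKernel _ hz)
      (integrable_nevanlinnaKernel _ hz)]
    push_cast
    ring

end BooleanSD

end

theorem mainTheorem2 (μ : ProbabilityMeasure ℝ) :
    BooleanSD.IsBooleanSelfdecomposable μ ↔
      (BooleanSD.booleanLevyMeasure μ ≪ (volume : Measure ℝ) ∧
        ∃ k : ℝ → ℝ, k =ᵐ[(volume : Measure ℝ)] BooleanSD.kFun μ ∧
          BooleanSD.IsUnimodalAtZero k) := by
  rw [BooleanSD.isBooleanSelfdecomposable_iff]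
  exact BooleanSD.map_mul_le_iff_unimodal
    (ν := BooleanSD.levyMeasure ((BooleanSD.booleanGeneratingPair μ).2 : Measure ℝ))
    (BooleanSD.levyMeasure_singleton_zero _)
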